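/- **Setting.** There are $M$ courses and $R\ge 1$ priority levels; a *schedule* is a set of courses. The *type* $v=(\succsim_v,r_v)$ of a student consists of a strict preference (linear order) $\succsim_v$ over all schedules (restrictions on the schedules she can take are incorporated in it) and a priority level $r_{v,c}\in\{1,\dots,R\}$ for each course $c$ (larger is higher). Let $\mathcal V$ be the (finite) set of possible types, and for each $v\in\mathcal V$ let $u_v$ be a von Neumann–Morgenstern utility over random schedules, with values in $[0,1]$, that represents $\succsim_v$ on schedules. For each $N$ there is an environment with $N$ students and course capacities $q^N_c$. Fix $\alpha,\beta\ge 0$. **Equilibrium.** For students with types $(v_s)$, an allocation $x=(x_s)$ of schedules, prices $p=(p_{c,r})$ and budgets $b=(b_s)$ form an $(\alpha,\beta)$-*Pseudo-Market Equilibrium with Priorities* if: (1) $x_s$ is the $\succsim_{v_s}$-best schedule $A$ with $\sum_{c\in A}p_{c,r_{v_s,c}}\le b_s$; (2) for some $\epsilon>0$ and $\bar b=1+\beta+\epsilon$, each course $c$ has a cutoff level $r^*_c$ with $p_{c,r}=0$ for $r>r_c^*$, $p_{c,r}\in[0,\bar b)$ for $r=r_c^*$ and $p_{c,r}\ge\bar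 b$ for $r<r^*_c$, and if some student has a seat in $c$, then so does some student with priority $r^*_c$ in $c$; (3) $\|z\|_2\le\alpha$, where $z_c=\#\{s:c\in x_s\}-q_c$ if $p_{c,1}>0$ and $z_c=\max(\#\{s:c\in x_s\}-q_c,0)$ if $p_{c,1}=0$; (4) $1\le b_s\le 1+\beta$ for all $s$. **Mechanism.** A *Pseudo-Market with Priorities (PMP) mechanism* collects reported types $v\in\mathcal V^N$, draws independent lottery numbers $\ell_s\sim U[0,1]$, gives student $s$ the budget $b_s=1+\ell_s\beta$, and implements the allocation of an $(\alpha,\beta)$-Pseudo-Market Equilibrium with Priorities for the reports and these budgets, chosen by some (possibly randomized, measurable) selection rule; if no such equilibrium exists for the reports and budgets at hand, no seats are assigned. Let $\Phi^N(v)$ be the resulting distribution over allocations. The mechanism is *semi-anonymous* if, when students with the same vector of priorities permute their reports among themselves, the distribution $\Phi^N(v)$ is permuted accordingly. **Theorem 5 (Strategy-Proofness).** Every sequence $(\Phi^N)_{N}$ of semi-anonymous PMP mechanisms is strategy-proof in the large: for every distribution $m$ on $\mathcal V$ with full support and every $\varepsilon>0$ there is $N_0$ such that, for all $N\ge N_0$,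 every student $s$ and all $v_s,v_s'\in\mathcal V$ with the same priorities ($r_{v_s}=r_{v_s'}$), $$u_{v_s}\big[\phi^N_s(v_s,m)\big]\ \ge\ u_{v_s}\big[\phi^N_s(v_s',m)\big]-\varepsilon ,$$ where $\phi^N_s(w,m)=\sum_{v_{-s}\in\mathcal V^{N-1}}\Phi^N_s(w,v_{-s})\prod_{j\ne s}m(v_j)$ is the random schedule that $s$ gets from reporting $w$ when the other students' reports are i.i.d. with distribution $m$. -/

import Mathlib

open MeasureTheory

namespace CourseAllocation

/-- A course schedule: a set of courses, the courses being numbered by `Fin M`. -/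
abbrev Schedule (M : ℕ) := Finset (Fin M)

/-- A strict preference over course schedules, i.e. a linear order on the set of all schedules;
`le A B` means that `B` is weakly preferred to `A`.  Schedules that a student cannot or does not
want to take (too many courses, overlapping meeting times, missing prerequisites) are those which
she ranks below the empty schedule. -/
structure Preference (M : ℕ) where
  le : Schedule M → Schedule M → Prop
  total : ∀ A B, le A B ∨ le B A
  trans : ∀ A B C, le A B → le B C → le A C
  antisymm : ∀ A B, le A B → le B A → A = B

/-- The type of a student: her preference together with her level of priority in every course.
The `R` priority levels are numbered by `Fin R`; `0` is the lowest level and a larger number is a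
higher priority. -/
structure StudentType (M R : ℕ) where
  pref : Preference M
  prio : Fin M → Fin R

/-- An allocation gives a schedule to each of the `N` students. -/
abbrev Allocation (N M : ℕ) := Fin N → Schedule M

/-- The number of students who are assigned a seat in course `c`. -/
def enrollment {N M : ℕ} (x : Allocation N M) (c : Fin M) : ℕ :=
  (Finset.univ.filter fun s : Fin N => c ∈ x s).card

/-- What schedule `A` costs a student of type `t` at the priority-specific prices `p`. -/
def cost {M R : ℕ} (p : Fin M → Fin R → ℝ) (t : StudentType M R) (A : Schedule M) : ℝ :=
  ∑ c ∈ A, p c (t.prio c)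

open Classical in
/-- The vector of market-clearing errors.  Under-enrollment counts only for those courses whose
price at the lowest priority level is positive. -/
noncomputable def clearingError {N M R : ℕ} [NeZero R] (q : Fin M → ℕ) (x : Allocation N M)
    (p : Fin M → Fin R → ℝ) : EuclideanSpace ℝ (Fin M) :=
  WithLp.toLp 2 fun c =>
    if 0 < p c 0 then (enrollment x c : ℝ) - q c else max ((enrollment x c : ℝ) - q c) 0

/-- The priority-specific prices of course `c` have a cutoff level of priority `r`: the price is
zero above the cutoff, in `[0, bbar)` at the cutoff, and at least `bbar` below the cutoff; and if
anybody is assigned a seat in the course then so is somebody at the cutoff level. -/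
def HasCutoff {N M R : ℕ} (t : Fin N → StudentType M R) (x : Allocation N M)
    (p : Fin M → Fin R → ℝ) (bbar : ℝ) (c : Fin M) (r : Fin R) : Prop :=
  (∀ r', r < r' → p c r' = 0) ∧ (0 ≤ p c r ∧ p c r < bbar) ∧ (∀ r', r' < r → bbar ≤ p c r') ∧
    ((∃ s, c ∈ x s) → ∃ s, (t s).prio c = r ∧ c ∈ x s)

/-- `(x, p, b)` is an `(α, β)`-Pseudo-Market Equilibrium with Priorities for students of types `t`
and course capacities `q`. -/
structure IsEquilibrium {N M R : ℕ} [NeZero R] (α β : ℝ) (q : Fin M → ℕ)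
    (t : Fin N → StudentType M R) (x : Allocation N M) (p : Fin M → Fin R → ℝ)
    (b : Fin N → ℝ) : Prop where
  affordable : ∀ s, cost p (t s) (x s) ≤ b s
  optimal : ∀ s A, cost p (t s) A ≤ b s → (t s).pref.le A (x s)
  cutoff : ∃ ε : ℝ, 0 < ε ∧ ∀ c, ∃ r, HasCutoff t x p (1 + β + ε) c r
  clearing : ‖clearingError q x p‖ ≤ α
  budget : ∀ s, 1 ≤ b s ∧ b s ≤ 1 + β

/-- The possible results `x` of the Pseudo-Market with Priorities mechanism when the students report
`t` and are given the budgets `b`: the allocation of an equilibrium; and if there is no equilibrium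
at all for these reports and budgets, no seats are assigned. -/
def IsOutcome {N M R : ℕ} [NeZero R] (α β : ℝ) (q : Fin M → ℕ) (t : Fin N → StudentType M R)
    (b : Fin N → ℝ) (x : Allocation N M) : Prop :=
  (∃ p, IsEquilibrium α β q t x p b) ∨
    ((¬ ∃ y p, IsEquilibrium α β q t y p b) ∧ ∀ s, x s = ∅)

section Mechanisms

variable {M R : ℕ} (V : Finset (StudentType M R))

/-- A direct mechanism for `N` students with types in `V`: every profile of reports is sent to
a probability distribution over allocations. -/
abbrev DirectMechanism (N : ℕ) := (Fin N → V) → stdSimplex ℝ (Allocation N M)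

variable {V}

/-- `Φ` is a Pseudo-Market with Priorities mechanism with market-clearing error `α` and budget
inequality `β`.  The students draw independent lottery numbers `ℓ s`, uniform in `[0, 1]`, and get
the budgets `1 + ℓ s * β`, which are uniform in `[1, 1 + β]`.  Then an equilibrium for the reported
types and these budgets is selected, according to a rule `x` which may itself randomize (a
deterministic rule is one whose values are point masses). -/
def IsPMP [NeZero R] {N : ℕ} (α β : ℝ) (q : Fin M → ℕ) (Φ : DirectMechanism V N) : Prop :=
  ∃ x : (Fin N → V) → (Fin N → unitInterval) → stdSimplex ℝ (Allocation N M),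
    (∀ v a, Measurable fun ℓ => x v ℓ a) ∧
    (∀ v, ∀ᵐ ℓ : Fin N → unitInterval, ∀ a, 0 < x v ℓ a →
      IsOutcome α β q (fun s => (v s).1) (fun s => 1 + (ℓ s : ℝ) * β) a) ∧
    ∀ v a, Φ v a = ∫ ℓ : Fin N → unitInterval, x v ℓ a

/-- A group consists of the students who have the same priority in every course.  The mechanism is
semi-anonymous if the students within each group are treated the same way: if the members of each
group exchange their reports among themselves, they exchange their assigned schedules. -/
def IsSemiAnonymous {N : ℕ} (Φ : DirectMechanism V N) : Prop :=
  ∀ (v : Fin N → V) (σ : Equiv.Perm (Fin N)), (∀ s, (v (σ s)).1.prio = (v s).1.prio) →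
    ∀ a : Allocation N M, Φ (v ∘ σ) (a ∘ σ) = Φ v a

/-- The profile of reports where student `s` reports `t` and the other students report `w`. -/
def profile {N : ℕ} (s : Fin N) (t : V) (w : {j : Fin N // j ≠ s} → V) : Fin N → V :=
  fun j => if h : j = s then t else w ⟨j, h⟩

/-- The probability that student `s` is assigned schedule `A` when she reports `t` and the reports
of the other students are independent with distribution `m`. -/
noncomputable def interim {N : ℕ} (Φ : DirectMechanism V N) (s : Fin N) (t : V)
    (m : stdSimplex ℝ V) (A : Schedule M) : ℝ :=
  ∑ w : {j : Fin N // j ≠ s} → V, (∏ j, m (w j)) *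
    ∑ a : Allocation N M, if a s = A then Φ (profile s t w) a else 0

/-- The expected utility of a random schedule with probabilities `φ`. -/
noncomputable def expectedUtility (u : Schedule M → ℝ) (φ : Schedule M → ℝ) : ℝ :=
  ∑ A, φ A * u A

/-- Strategy-proofness in the large of a sequence of mechanisms, for students of type `t` with the
von Neumann–Morgenstern utility `u t`.  Students can misreport preferences, not priorities. -/
def IsStrategyProofInTheLarge (u : V → Schedule M → ℝ) (Φ : ∀ N, DirectMechanism V N) : Prop :=
  ∀ m : stdSimplex ℝ V, (∀ t, 0 < m t) → ∀ ε : ℝ, 0 < ε → ∃ N₀ : ℕ, ∀ N, N₀ ≤ N →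
    ∀ (s : Fin N) (t t' : V), t.1.prio = t'.1.prio →
      expectedUtility (u t) (interim (Φ N) s t m) ≥
        expectedUtility (u t) (interim (Φ N) s t' m) - ε

end Mechanisms

end CourseAllocation

/-! Two students with the same priorities face the same prices, so the one with the larger lottery
number can afford the other's schedule and does not envy it (`IsOutcome.utility_le`). Whatever a
misreport seems to gain is therefore luck in the lottery, and luck averages out in a large group.

Let all reports be i.i.d. with law `m`. The interim utilities of the reports `t` and `t'` differ by
the mean of the utility of `s` times `contrast`. Semi-anonymity allows the value at `s` to be
replaced by its average over the priority group of `s` (`sum_mul_eq_sum_mul_group_average`). Two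
hypothetical reports of one student thus become reports of actual students under one lottery draw.

Cut `[0, 1]` into `k + 1` bins and match the reports of `t` in bin `i + 1` with those of `t'` in bin
`i`. Absence of envy across matched bins (`neg_le_sum_mul_contrast`) leaves two losses: the
unmatched top bin of `t'`, a share `1 / (k + 1)`, and the fluctuation of the bin counts, of order
`√N` (`reportMean_abs_sum_reports_le`). The group has size at least `N * m t / 2` outside an event
controlled by a second moment, so the loss per member is small once `k` is large and then `N` is
large. -/

namespace CourseAllocation

/-! ### Moments of sums over independent reports and lottery numbers -/

section ReportMean

variable {T : Type*} {N : ℕ}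

theorem integrable_of_measurable_of_abs_le {f : (Fin N → unitInterval) → ℝ} {C : ℝ}
    (hf : Measurable f) (h : ∀ ℓ, |f ℓ| ≤ C) : Integrable f :=
  Integrable.of_bound hf.aestronglyMeasurable C (Filter.Eventually.of_forall h)

theorem measurable_sum_reports {f : T → unitInterval → ℝ} (hf : ∀ t, Measurable (f t))
    (v : Fin N → T) : Measurable fun ℓ : Fin N → unitInterval => ∑ j, f (v j) (ℓ j) :=
  Finset.measurable_sum _ fun j _ => (hf (v j)).comp (measurable_pi_apply j)

theorem abs_sum_reports_le {f : T → unitInterval → ℝ} {C : ℝ} (hC : ∀ t l, |f t l| ≤ C)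
    (v : Fin N → T) (ℓ : Fin N → unitInterval) : |∑ j, f (v j) (ℓ j)| ≤ N * C :=
  (Finset.abs_sum_le_sum_abs _ _).trans <| (Finset.sum_le_sum fun j _ => hC (v j) (ℓ j)).trans
    (by simp)

theorem integrable_sum_reports {f : T → unitInterval → ℝ} (hf : ∀ t, Measurable (f t)) {C : ℝ}
    (hC : ∀ t l, |f t l| ≤ C) (v : Fin N → T) :
    Integrable fun ℓ : Fin N → unitInterval => ∑ j, f (v j) (ℓ j) :=
  integrable_of_measurable_of_abs_le (measurable_sum_reports hf v) (abs_sum_reports_le hC v)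

theorem integrable_sq_sum_reports {f : T → unitInterval → ℝ} (hf : ∀ t, Measurable (f t)) {C : ℝ}
    (hC : ∀ t l, |f t l| ≤ C) (v : Fin N → T) :
    Integrable fun ℓ : Fin N → unitInterval => (∑ j, f (v j) (ℓ j)) ^ 2 :=
  integrable_of_measurable_of_abs_le ((measurable_sum_reports hf v).pow_const 2)
    (C := (N * C) ^ 2) fun ℓ => by
      rw [abs_pow]
      exact pow_le_pow_left₀ (abs_nonneg _) (abs_sum_reports_le hC v ℓ) 2

variable [Fintype T]

/-- The expectation of a function of the reports, independent with distribution `m`, and of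
the lottery numbers, independent and uniform in `[0, 1]`. -/
noncomputable def reportMean (m : T → ℝ)
    (F : (Fin N → T) → (Fin N → unitInterval) → ℝ) : ℝ :=
  ∑ v : Fin N → T, (∏ j, m (v j)) * ∫ ℓ : Fin N → unitInterval, F v ℓ

theorem reportMean_mono {m : T → ℝ} (hm : ∀ t, 0 ≤ m t)
    {F G : (Fin N → T) → (Fin N → unitInterval) → ℝ}
    (hF : ∀ v, Integrable (F v)) (hG : ∀ v, Integrable (G v)) (h : ∀ v ℓ, F v ℓ ≤ G v ℓ) :
    reportMean m F ≤ reportMean m G :=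
  Finset.sum_le_sum fun v _ => mul_le_mul_of_nonneg_left
    (integral_mono (hF v) (hG v) (h v)) (Finset.prod_nonneg fun _ _ => hm _)

theorem reportMean_add {m : T → ℝ}
    {F G : (Fin N → T) → (Fin N → unitInterval) → ℝ}
    (hF : ∀ v, Integrable (F v)) (hG : ∀ v, Integrable (G v)) :
    reportMean m (fun v ℓ => F v ℓ + G v ℓ) = reportMean m F + reportMean m G := by
  simp only [reportMean, ← Finset.sum_add_distrib, ← mul_add]
  exact Finset.sum_congr rfl fun v _ => by rw [integral_add (hF v) (hG v)]

theorem reportMean_const_mul (m : T → ℝ) (c : ℝ)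
    (F : (Fin N → T) → (Fin N → unitInterval) → ℝ) :
    reportMean m (fun v ℓ => c * F v ℓ) = c * reportMean m F := by
  simp only [reportMean, Finset.mul_sum, integral_const_mul]
  exact Finset.sum_congr rfl fun v _ => by ring

theorem reportMean_finset_sum (m : T → ℝ) {κ : Type*} (s : Finset κ)
    {F : κ → (Fin N → T) → (Fin N → unitInterval) → ℝ}
    (hF : ∀ i ∈ s, ∀ v, Integrable (F i v)) :
    reportMean m (fun v ℓ => ∑ i ∈ s, F i v ℓ) = ∑ i ∈ s, reportMean m (F i) := by
  simp only [reportMean]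
  rw [Finset.sum_comm]
  refine Finset.sum_congr rfl fun v _ => ?_
  rw [integral_finsetSum s fun i hi => hF i hi v, Finset.mul_sum]

/-- The factors of a product that depend on distinct students are independent. -/
theorem reportMean_prod (m : T → ℝ) (f : Fin N → T → unitInterval → ℝ) :
    reportMean m (fun v ℓ => ∏ j, f j (v j) (ℓ j)) = ∏ j, ∑ t, m t * ∫ l, f j t l := by
  classical
  simp only [reportMean]
  rw [Finset.prod_univ_sum, Fintype.piFinset_univ]
  refine Finset.sum_congr rfl fun v _ => ?_
  rw [integral_fintype_prod_volume_eq_prod (fun j => f j (v j)), Finset.prod_mul_distrib]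

/-- Students outside `s` contribute the factor `1`, whose mean is `1` because `m` has total mass
one. Sets of one or two students give the means and covariances used below. -/
theorem reportMean_prod_subset {m : T → ℝ} (hm : ∑ t, m t = 1) (s : Finset (Fin N))
    (f : T → unitInterval → ℝ) :
    reportMean m (fun v ℓ => ∏ j ∈ s, f (v j) (ℓ j)) = (∑ t, m t * ∫ l, f t l) ^ s.card := by
  classical
  have h := reportMean_prod m (fun (j : Fin N) t l => if j ∈ s then f t l else 1)
  simp only [Finset.prod_ite_mem, Finset.univ_inter] at h
  have h1 (j : Fin N) : (∑ t, m t * ∫ l, if j ∈ s then f t l else 1) =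
      if j ∈ s then ∑ t, m t * ∫ l, f t l else 1 := by
    split_ifs <;> simp [hm]
  simp only [h, h1, Finset.prod_ite_mem, Finset.univ_inter, Finset.prod_const]

theorem reportMean_const {m : T → ℝ} (hm : ∑ t, m t = 1) (c : ℝ) :
    reportMean m (fun (_ : Fin N → T) _ => c) = c := by
  have h := reportMean_const_mul (N := N) m c (fun _ _ => 1)
  have h1 := reportMean_prod_subset (N := N) hm ∅ (fun _ _ => 1)
  simp only [Finset.prod_empty, Finset.card_empty, pow_zero] at h1
  simpa [h1] using h

theorem reportMean_sum_reports {m : T → ℝ} (hm : ∑ t, m t = 1) {f : T → unitInterval → ℝ}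
    (hf : ∀ t, Measurable (f t)) {C : ℝ} (hC : ∀ t l, |f t l| ≤ C) :
    reportMean m (fun (v : Fin N → T) ℓ => ∑ j, f (v j) (ℓ j)) =
      N * ∑ t, m t * ∫ l, f t l := by
  have hint (j : Fin N) (v : Fin N → T) :
      Integrable fun ℓ : Fin N → unitInterval => f (v j) (ℓ j) :=
    integrable_of_measurable_of_abs_le ((hf (v j)).comp (measurable_pi_apply j))
      fun ℓ => hC (v j) (ℓ j)
  rw [reportMean_finset_sum m Finset.univ fun j _ v => hint j v]
  have h (j : Fin N) : reportMean m (fun (v : Fin N → T) ℓ => f (v j) (ℓ j)) =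
      ∑ t, m t * ∫ l, f t l := by
    simpa using reportMean_prod_subset hm {j} f
  simp [h]

/-- A sum of independent centred random variables bounded by `C`, one for each student, has second
moment at most `N * C ^ 2`. -/
theorem reportMean_sq_sum_reports_le {m : T → ℝ} (hm0 : ∀ t, 0 ≤ m t) (hm : ∑ t, m t = 1)
    {f : T → unitInterval → ℝ} (hf : ∀ t, Measurable (f t)) {C : ℝ} (hC : ∀ t l, |f t l| ≤ C)
    (h0 : ∑ t, m t * ∫ l, f t l = 0) :
    reportMean m (fun (v : Fin N → T) ℓ => (∑ j, f (v j) (ℓ j)) ^ 2) ≤ N * C ^ 2 := by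
  have hmeas (j j' : Fin N) (v : Fin N → T) :
      Integrable fun ℓ : Fin N → unitInterval => f (v j) (ℓ j) * f (v j') (ℓ j') :=
    integrable_of_measurable_of_abs_le
      (((hf (v j)).comp (measurable_pi_apply j)).mul ((hf (v j')).comp (measurable_pi_apply j')))
      (C := C * C) fun ℓ => by
        rw [abs_mul]
        exact mul_le_mul (hC _ _) (hC _ _) (abs_nonneg _) ((abs_nonneg _).trans (hC (v j) (ℓ j)))
  simp only [sq, Finset.sum_mul_sum]
  rw [reportMean_finset_sum m Finset.univ fun j _ v => integrable_finsetSum _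
    fun j' _ => hmeas j j' v]
  have key (j : Fin N) : reportMean m (fun (v : Fin N → T) ℓ =>
      ∑ j', f (v j) (ℓ j) * f (v j') (ℓ j')) ≤ C * C := by
    rw [reportMean_finset_sum m Finset.univ fun j' _ v => hmeas j j' v,
      Finset.sum_eq_single_of_mem j (Finset.mem_univ j)]
    · refine (reportMean_mono hm0 (hmeas j j) (fun _ => integrable_const (C * C))
        fun v ℓ => ?_).trans_eq (reportMean_const hm _)
      rw [← abs_mul_abs_self]
      exact mul_self_le_mul_self (abs_nonneg _) (hC _ _)
    -- Distinct students are independent and centred, so the cross terms vanish.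
    · intro j' _ hj
      have h := reportMean_prod_subset hm {j, j'} f
      simpa [Finset.prod_pair hj.symm, h0, Finset.card_pair hj.symm] using h
  refine (Finset.sum_le_sum fun j _ => key j).trans_eq (by simp)

/-- The mean absolute value of a sum of independent centred random variables, one for each student,
is of the order of the square root of the number of students. -/
theorem reportMean_abs_sum_reports_le {m : T → ℝ} (hm0 : ∀ t, 0 ≤ m t) (hm : ∑ t, m t = 1)
    {f : T → unitInterval → ℝ} (hf : ∀ t, Measurable (f t)) {C : ℝ} (hC : ∀ t l, |f t l| ≤ C)
    (h0 : ∑ t, m t * ∫ l, f t l = 0) (hN : 0 < N) :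
    reportMean m (fun (v : Fin N → T) ℓ => |∑ j, f (v j) (ℓ j)|) ≤ √N * (C ^ 2 + 1) := by
  have hN' : (0 : ℝ) < √N := Real.sqrt_pos.2 (by exact_mod_cast hN)
  have hint := fun v : Fin N → T => integrable_sq_sum_reports hf hC v
  -- Pointwise `x ≤ x ^ 2 / √N + √N`; the weight `√N` balances the two terms when `x ^ 2` has mean
  -- of order `N`.
  calc _ ≤ reportMean m (fun (v : Fin N → T) ℓ =>
        (√N)⁻¹ * (∑ j, f (v j) (ℓ j)) ^ 2 + √N) := by
        refine reportMean_mono hm0 (fun v => (integrable_sum_reports hf hC v).abs)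
          (fun v => ((hint v).const_mul _).add (integrable_const _)) fun v ℓ => ?_
        rw [← sq_abs, ← sub_nonneg]
        set x := |∑ j, f (v j) (ℓ j)|
        have hx : 0 ≤ x := abs_nonneg _
        have : (√N)⁻¹ * x ^ 2 + √N - x = (√N)⁻¹ * ((x - √N) ^ 2 + x * √N) := by
          field_simp
          ring
        rw [this]
        positivity
    _ = (√N)⁻¹ * reportMean m (fun (v : Fin N → T) ℓ => (∑ j, f (v j) (ℓ j)) ^ 2) + √N := by
        rw [reportMean_add (fun v => (hint v).const_mul _) (fun v => integrable_const _),
          reportMean_const_mul, reportMean_const hm]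
    _ ≤ (√N)⁻¹ * (N * C ^ 2) + √N := by
        gcongr
        exact reportMean_sq_sum_reports_le hm0 hm hf hC h0
    _ = √N * (C ^ 2 + 1) := by
        have : (N : ℝ) = √N * √N := (Real.mul_self_sqrt (Nat.cast_nonneg N)).symm
        rw [this, Real.sqrt_mul_self hN'.le]
        field_simp

end ReportMean

/-! ### Averaging over a priority group -/

section Symmetrization

variable {T ρ : Type*} [Fintype T] [DecidableEq ρ] {N : ℕ}

/-- In the mean over exchangeable reports, a quantity attached to student `s` may be replaced by its
average over the members of the group of `s`, if permutations within the group permute it. -/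
theorem sum_mul_eq_sum_mul_group_average (g : T → ρ) (r : ρ) (s : Fin N)
    {P : (Fin N → T) → ℝ} {G : (Fin N → T) → Fin N → ℝ}
    (hP : ∀ v (σ : Equiv.Perm (Fin N)), P (v ∘ σ) = P v)
    (hG : ∀ v (σ : Equiv.Perm (Fin N)), (∀ j, g (v (σ j)) = g (v j)) →
      ∀ j, G (v ∘ σ) j = G v (σ j))
    (h0 : ∀ v j, g (v j) ≠ r → G v j = 0) :
    ∑ v, P v * G v s = ∑ v, P v * if g (v s) = r then
      ((Finset.univ.filter fun j => g (v j) = r).card : ℝ)⁻¹ * ∑ j, G v j else 0 := by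
  set c : (Fin N → T) → ℝ := fun v => ((Finset.univ.filter fun j => g (v j) = r).card : ℝ)⁻¹
    with hc
  have hcσ (v : Fin N → T) (σ : Equiv.Perm (Fin N)) : c (v ∘ σ) = c v := by
    simp only [hc, Function.comp]
    congr 2
    exact Finset.card_equiv σ (by simp)
  -- Relabelling the profiles by the transposition of `s` and `j` preserves the law. It respects
  -- groups when both students lie in group `r`; otherwise both summands vanish.
  have swap_sum (j : Fin N) :
      ∑ v, P v * (if g (v s) = r then c v * G v j else 0) =
        ∑ v, P v * (if g (v j) = r then c v * G v s else 0) := by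
    let σ : Equiv.Perm (Fin N) := Equiv.swap s j
    let e : (Fin N → T) ≃ (Fin N → T) := σ.arrowCongr (Equiv.refl T)
    have he (v : Fin N → T) : e v = v ∘ σ := by
      ext i
      simp [e, σ, Equiv.arrowCongr]
    rw [← e.sum_comp (fun v => P v * (if g (v j) = r then c v * G v s else 0))]
    refine Finset.sum_congr rfl fun v _ => ?_
    rw [he, hP, hcσ]
    have hj : (v ∘ σ) j = v s := by simp [σ]
    have hs : (v ∘ σ) s = v j := by simp [σ]
    rw [hj]
    by_cases h1 : g (v s) = r
    · by_cases h2 : g (v j) = r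
      · rw [hG v σ ?_ s, show σ s = j from Equiv.swap_apply_left s j]
        intro i
        by_cases his : i = s
        · subst his; simp [σ, h1, h2]
        · by_cases hij : i = j
          · subst hij; simp [σ, h1, h2]
          · simp [σ, Equiv.swap_apply_of_ne_of_ne his hij]
      · rw [h0 v j h2, h0 (v ∘ σ) s (by rwa [hs])]
    · simp [h1]
  symm
  calc ∑ v, P v * (if g (v s) = r then c v * ∑ j, G v j else 0)
      = ∑ j, ∑ v, P v * (if g (v s) = r then c v * G v j else 0) := by
        rw [Finset.sum_comm]
        refine Finset.sum_congr rfl fun v _ => ?_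
        rw [← Finset.mul_sum]
        split_ifs <;> simp [Finset.mul_sum]
    _ = ∑ v, ∑ j, P v * (if g (v j) = r then c v * G v s else 0) := by
        simp only [swap_sum]
        exact Finset.sum_comm
    _ = ∑ v, P v * G v s := by
        refine Finset.sum_congr rfl fun v _ => ?_
        rw [← Finset.mul_sum, ← Finset.sum_filter, Finset.sum_const, nsmul_eq_mul]
        by_cases h1 : g (v s) = r
        · have : ((Finset.univ.filter fun j => g (v j) = r).card : ℝ) ≠ 0 := by
            rw [Nat.cast_ne_zero]
            exact Finset.card_ne_zero_of_mem (Finset.mem_filter.2 ⟨Finset.mem_univ s, h1⟩)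
          simp only [hc]
          rw [mul_inv_cancel_left₀ this]
        · simp [h0 v s h1]

end Symmetrization

/-! ### Interim utilities and absence of envy -/

section Utility

variable {M R N : ℕ} {V : Finset (StudentType M R)}

/-- The utility that student `j` expects at the reports `v`, for a utility function `u`. -/
noncomputable def outcomeUtility (Φ : DirectMechanism V N) (u : Schedule M → ℝ) (v : Fin N → V)
    (j : Fin N) : ℝ :=
  ∑ a : Allocation N M, Φ v a * u (a j)

theorem expectedUtility_interim (Φ : DirectMechanism V N) (u : Schedule M → ℝ) (s : Fin N) (t : V)
    (m : stdSimplex ℝ V) :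
    expectedUtility u (interim Φ s t m) =
      ∑ w : {j : Fin N // j ≠ s} → V, (∏ j, m (w j)) * outcomeUtility Φ u (profile s t w) s := by
  simp only [expectedUtility, interim, outcomeUtility, Finset.sum_mul]
  rw [Finset.sum_comm]
  refine Finset.sum_congr rfl fun w _ => ?_
  simp only [mul_assoc, ← Finset.mul_sum, Finset.sum_mul]
  rw [Finset.sum_comm]
  simp [ite_mul]

open Classical in
/-- The interim utility of the report `t` is the mean utility conditional on `s` reporting `t`, when
the reports of all students are random. -/
theorem mul_expectedUtility_interim (Φ : DirectMechanism V N) (u : Schedule M → ℝ) (s : Fin N)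
    (t : V) (m : stdSimplex ℝ V) :
    m t * expectedUtility u (interim Φ s t m) =
      ∑ v : Fin N → V, (∏ j, m (v j)) * if v s = t then outcomeUtility Φ u v s else 0 := by
  rw [expectedUtility_interim, ← (Equiv.funSplitAt s V).symm.sum_comp, Fintype.sum_prod_type,
    Finset.sum_eq_single_of_mem t (Finset.mem_univ t)]
  · rw [Finset.mul_sum]
    refine Finset.sum_congr rfl fun w _ => ?_
    have hp : (Equiv.funSplitAt s V).symm (t, w) = profile s t w := by
      ext1 j
      by_cases h : j = s
      · subst h; simp [profile, Equiv.funSplitAt, Equiv.piSplitAt]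
      · simp [profile, Equiv.funSplitAt, Equiv.piSplitAt, h]
    have hs : profile s t w s = t := by simp [profile]
    rw [hp, if_pos hs, ← mul_assoc, Fintype.prod_eq_mul_prod_subtype_ne _ s, hs]
    congr 2
    exact Finset.prod_congr rfl fun j _ => by simp [profile, j.2]
  · intro t' _ ht
    refine Finset.sum_eq_zero fun w _ => ?_
    rw [if_neg, mul_zero]
    simpa [Equiv.funSplitAt, Equiv.piSplitAt] using ht

theorem IsSemiAnonymous.outcomeUtility_comp {Φ : DirectMechanism V N} (h : IsSemiAnonymous Φ)
    (u : Schedule M → ℝ) (v : Fin N → V) (σ : Equiv.Perm (Fin N))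
    (hσ : ∀ s, (v (σ s)).1.prio = (v s).1.prio) (j : Fin N) :
    outcomeUtility Φ u (v ∘ σ) j = outcomeUtility Φ u v (σ j) := by
  let e : Allocation N M ≃ Allocation N M := σ.symm.arrowCongr (Equiv.refl _)
  have he (a : Allocation N M) : e a = a ∘ σ := by
    ext1 i
    simp [e, Equiv.arrowCongr]
  simp only [outcomeUtility]
  rw [← e.sum_comp]
  exact Finset.sum_congr rfl fun a _ => by rw [he, h v σ hσ a, Function.comp_apply]

/-- A student weakly prefers her assignment to that of every student of the same priority with
a smaller budget. -/
theorem IsOutcome.utility_le [NeZero R] {α β : ℝ} {q : Fin M → ℕ} {t : Fin N → StudentType M R}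
    {b : Fin N → ℝ} {x : Allocation N M} (h : IsOutcome α β q t b x) {i j : Fin N}
    {u : Schedule M → ℝ} (hu : ∀ A B, u A ≤ u B ↔ (t i).pref.le A B)
    (hprio : (t i).prio = (t j).prio) (hb : b j ≤ b i) : u (x j) ≤ u (x i) := by
  rcases h with ⟨p, hp⟩ | ⟨-, hx⟩
  · refine (hu _ _).2 (hp.optimal i _ (le_trans (le_of_eq ?_) ((hp.affordable j).trans hb)))
    simp [cost, hprio]
  · rw [hx i, hx j]

end Utility

/-! ### Comparison of two reports across lottery bins -/

section Contrast

variable {T : Type*} [DecidableEq T]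

/-- The weight of a report in the comparison of the reports `t` and `t'`, of probabilities
`p` and `p'`. -/
noncomputable def contrast (t t' : T) (p p' : ℝ) (τ : T) : ℝ :=
  (if τ = t then p⁻¹ else 0) - if τ = t' then p'⁻¹ else 0

/-- The weight of a report with lottery number in bin `n`, in the comparison of the reports of `t`
with lottery number in bin `i + 1` and the reports of `t'` with lottery number in bin `i`. -/
noncomputable def binContrast (t t' : T) (p p' : ℝ) (i : ℕ) (τ : T) (n : ℕ) : ℝ :=
  (if τ = t ∧ n = i + 1 then p⁻¹ else 0) - if τ = t' ∧ n = i then p'⁻¹ else 0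

/-- The weight of a report of `t'` with lottery number in a bin from `k` on. -/
noncomputable def topWeight (t' : T) (p' : ℝ) (k : ℕ) (τ : T) (n : ℕ) : ℝ :=
  if τ = t' ∧ k ≤ n then p'⁻¹ else 0

variable {N : ℕ}

/-- If a student of type `t` gets at least the utility of every student of type `t'` whose
lottery number is in a lower bin, then students of type `t` are better off on average, up to the
deviations of the numbers of students in the bins. -/
theorem neg_le_sum_mul_contrast {t t' : T} {p p' : ℝ} (hp : 0 < p) (hp' : 0 < p')
    (v : Fin N → T) (b : Fin N → ℕ) (y : Fin N → ℝ) (hy : ∀ j, y j ∈ Set.Icc (0 : ℝ) 1)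
    (hle : ∀ i j, v i = t → v j = t' → b j < b i → y j ≤ y i) (k : ℕ) :
    -(∑ i ∈ Finset.range k, |∑ j, binContrast t t' p p' i (v j) (b j)| +
      ∑ j, topWeight t' p' k (v j) (b j)) ≤ ∑ j, y j * contrast t t' p p' (v j) := by
  -- The threshold `z i` is the best utility among reports of `t'` in bin `i`, or `0` if there are
  -- none. It separates these reports from those of `t` in bin `i + 1`.
  have hex (i : ℕ) : ∃ z ∈ Set.Icc (0 : ℝ) 1, (∀ j, v j = t' → b j = i → y j ≤ z) ∧
      ∀ j, v j = t → b j = i + 1 → z ≤ y j := by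
    by_cases hne : (Finset.univ.filter fun j => v j = t' ∧ b j = i).Nonempty
    · obtain ⟨j₀, hj₀, hmax⟩ := Finset.exists_max_image _ y hne
      rw [Finset.mem_filter] at hj₀
      refine ⟨y j₀, hy j₀, fun j h1 h2 => hmax j (by simp [h1, h2]), fun j h1 h2 => ?_⟩
      exact hle j j₀ h1 hj₀.2.1 (by rw [hj₀.2.2, h2]; exact Nat.lt_succ_self i)
    · refine ⟨0, by simp, fun j h1 h2 => ?_, fun j _ _ => (hy j).1⟩
      exact absurd ⟨j, by simp [h1, h2]⟩ hne
  choose z hz01 hz' hz using hex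
  -- Reports of `t` in bin `0` or beyond bin `k` have no partner; dropping them only lowers the sum
  -- since `y ≥ 0`.
  have hlow (j : Fin N) : ∑ i ∈ Finset.range k, z i * (if v j = t ∧ b j = i + 1 then p⁻¹ else 0) ≤
      y j * if v j = t then p⁻¹ else 0 := by
    by_cases hv : v j = t
    · rcases Nat.eq_zero_or_pos (b j) with hb | hb
      · rw [Finset.sum_eq_zero fun i _ => by simp [hb]]
        exact mul_nonneg (hy j).1 (by positivity)
      · by_cases hk : b j - 1 ∈ Finset.range k
        · rw [Finset.sum_eq_single_of_mem (b j - 1) hk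
            fun i _ hi => by rw [if_neg (by omega), mul_zero]]
          have hb' : b j = b j - 1 + 1 := by omega
          rw [if_pos ⟨hv, hb'⟩, if_pos hv]
          exact mul_le_mul_of_nonneg_right (hz _ j hv hb') (by positivity)
        · rw [Finset.sum_eq_zero fun i hi => by
            rw [if_neg (by rw [Finset.mem_range] at hk hi; omega), mul_zero]]
          exact mul_nonneg (hy j).1 (by positivity)
    · simp [hv]
  -- Reports of `t'` from bin `k` on have no partner either and are charged in full, using `y ≤ 1`.
  have hupp (j : Fin N) : (y j * if v j = t' then p'⁻¹ else 0) ≤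
      ∑ i ∈ Finset.range k, z i * (if v j = t' ∧ b j = i then p'⁻¹ else 0) +
        topWeight t' p' k (v j) (b j) := by
    by_cases hv : v j = t'
    · by_cases hk : b j ∈ Finset.range k
      · rw [Finset.sum_eq_single_of_mem (b j) hk fun i _ hi => by
          rw [if_neg (fun h => hi h.2.symm), mul_zero], if_pos hv, if_pos ⟨hv, rfl⟩, topWeight,
          if_neg (by rw [Finset.mem_range] at hk; omega), add_zero]
        exact mul_le_mul_of_nonneg_right (hz' _ j hv rfl) (by positivity)
      · rw [Finset.sum_eq_zero fun i hi => by
          rw [if_neg (by rw [Finset.mem_range] at hk hi; omega), mul_zero], if_pos hv, topWeight,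
          if_pos ⟨hv, by rw [Finset.mem_range] at hk; omega⟩, zero_add]
        exact mul_le_of_le_one_left (by positivity) (hy j).2
    · simp [hv, topWeight]
  have hj (j : Fin N) : ∑ i ∈ Finset.range k, z i * binContrast t t' p p' i (v j) (b j) -
      topWeight t' p' k (v j) (b j) ≤ y j * contrast t t' p p' (v j) := by
    simp only [binContrast, contrast, mul_sub, Finset.sum_sub_distrib]
    linarith [hlow j, hupp j]
  refine le_trans ?_ (Finset.sum_le_sum fun j _ => hj j)
  rw [Finset.sum_sub_distrib, Finset.sum_comm, neg_add, ← sub_eq_add_neg]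
  refine sub_le_sub_right ?_ _
  rw [← Finset.sum_neg_distrib]
  refine Finset.sum_le_sum fun i _ => ?_
  rw [← Finset.mul_sum]
  refine (neg_le_neg ?_).trans (neg_abs_le _)
  rw [abs_mul, abs_of_nonneg (hz01 i).1]
  exact mul_le_of_le_one_left (abs_nonneg _) (hz01 i).2

/-- A crude bound that stays useful after division by the group size, even when the group is
atypically small. -/
theorem neg_card_mul_inv_le_sum_mul_contrast {t t' : T} {p p' : ℝ} (hp : 0 < p) (hp' : 0 < p')
    (v : Fin N → T) (y : Fin N → ℝ) (hy : ∀ j, y j ∈ Set.Icc (0 : ℝ) 1) (s : Finset (Fin N))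
    (hs : ∀ j, v j = t' → j ∈ s) :
    -(s.card * p'⁻¹) ≤ ∑ j, y j * contrast t t' p p' (v j) := by
  have hj (j : Fin N) : -(if j ∈ s then p'⁻¹ else 0) ≤ y j * contrast t t' p p' (v j) := by
    have h1 : 0 ≤ y j * if v j = t then p⁻¹ else 0 :=
      mul_nonneg (hy j).1 (by split_ifs <;> positivity)
    have h2 : (y j * if v j = t' then p'⁻¹ else 0) ≤ if j ∈ s then p'⁻¹ else 0 := by
      by_cases hv : v j = t'
      · rw [if_pos hv, if_pos (hs j hv)]
        exact mul_le_of_le_one_left (by positivity) (hy j).2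
      · rw [if_neg hv, mul_zero]
        split_ifs <;> positivity
    rw [contrast, mul_sub]
    linarith
  refine le_trans (le_of_eq ?_) (Finset.sum_le_sum fun j _ => hj j)
  simp [Finset.sum_neg_distrib]

/-- Here `J` is the group size and `D` the excess of the number of reports of `t` over its mean `n *
p`. If `J ≥ n * p / 2`, the bound `E` is divided by a large number. Otherwise `D < -(n * p / 2)`,
and the coefficient of `D ^ 2` is chosen so that this term alone covers the crude loss `p'⁻¹`. -/
theorem neg_le_inv_mul_of_deviation {J L E D n p p' : ℝ} (hJ : 0 < J) (hn : 0 < n) (hp : 0 < p)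
    (hp' : 0 < p') (hE : 0 ≤ E) (hLE : -E ≤ L) (hLJ : -(J * p'⁻¹) ≤ L) (hD : D + n * p ≤ J) :
    -(2 / (n * p) * E + 4 / (n ^ 2 * p ^ 2 * p') * D ^ 2) ≤ J⁻¹ * L := by
  have hnp : 0 < n * p := mul_pos hn hp
  rcases le_or_gt (n * p / 2) J with h | h
  · have h1 : J⁻¹ ≤ 2 / (n * p) := by
      rw [inv_le_comm₀ hJ (by positivity), inv_div]
      exact h
    have h2 : J⁻¹ * -E ≤ J⁻¹ * L := mul_le_mul_of_nonneg_left hLE (by positivity)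
    have h3 : J⁻¹ * E ≤ 2 / (n * p) * E := mul_le_mul_of_nonneg_right h1 hE
    have h4 : 0 ≤ 4 / (n ^ 2 * p ^ 2 * p') * D ^ 2 := by positivity
    linarith
  · have h1 : (n * p / 2) ^ 2 ≤ D ^ 2 := by
      rw [← neg_sq D]
      exact pow_le_pow_left₀ (by positivity) (by linarith) 2
    have h2 : p'⁻¹ ≤ 4 / (n ^ 2 * p ^ 2 * p') * D ^ 2 := by
      calc p'⁻¹ = 4 / (n ^ 2 * p ^ 2 * p') * (n * p / 2) ^ 2 := by field_simp; norm_num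
        _ ≤ _ := by gcongr
    have h3 : J⁻¹ * -(J * p'⁻¹) ≤ J⁻¹ * L := mul_le_mul_of_nonneg_left hLJ (by positivity)
    have h4 : J⁻¹ * -(J * p'⁻¹) = -p'⁻¹ := by field_simp
    have h5 : 0 ≤ 2 / (n * p) * E := by positivity
    linarith

end Contrast

/-! ### Lottery bins and their probabilities -/

section LotteryBins

/-- The bin of a lottery number when `[0, 1]` is divided into `K` intervals of equal length. -/
noncomputable def lotteryBin (K : ℕ) (l : unitInterval) : ℕ := ⌊(K : ℝ) * l⌋₊

theorem measurable_lotteryBin (K : ℕ) : Measurable (lotteryBin K) :=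
  Nat.measurable_floor.comp (measurable_const.mul measurable_subtype_coe)

theorem lt_of_lotteryBin_lt {K : ℕ} {l l' : unitInterval} (h : lotteryBin K l < lotteryBin K l') :
    l < l' := by
  by_contra! hl
  exact absurd h (not_lt.2 (Nat.floor_le_floor
    (mul_le_mul_of_nonneg_left (show (l' : ℝ) ≤ l from hl) (Nat.cast_nonneg K))))

/-- The restriction `i < K` matters: bin `K` contains only the lottery number `1`. -/
theorem volume_lotteryBin_eq {K i : ℕ} (hi : i < K) :
    volume.real {l | lotteryBin K l = i} = (K : ℝ)⁻¹ := by
  have hK : (0 : ℝ) < K := by exact_mod_cast (Nat.zero_le i).trans_lt hi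
  have hi1 : (i : ℝ) + 1 ≤ K := by exact_mod_cast hi
  have h : {l | lotteryBin K l = i} = Set.Ico
      (⟨i / K, by positivity, by rw [div_le_one hK]; linarith⟩ : unitInterval)
      ⟨(i + 1) / K, by positivity, by rwa [div_le_one hK]⟩ := by
    ext l
    rw [Set.mem_ofPred_eq, lotteryBin, Nat.floor_eq_iff (mul_nonneg hK.le l.2.1), Set.mem_Ico,
      ← Subtype.coe_le_coe, ← Subtype.coe_lt_coe, div_le_iff₀' hK, lt_div_iff₀' hK]
  have hsub : ((i : ℝ) + 1) / K - i / K = (K : ℝ)⁻¹ := by field_simp; ring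
  rw [h, measureReal_def, unitInterval.volume_Ico]
  simp only [hsub]
  exact ENNReal.toReal_ofReal (by positivity)

theorem volume_le_lotteryBin (k : ℕ) :
    volume.real {l | k ≤ lotteryBin (k + 1) l} = ((k : ℝ) + 1)⁻¹ := by
  have hK : (0 : ℝ) < k + 1 := by positivity
  have h : {l | k ≤ lotteryBin (k + 1) l} = Set.Ici
      (⟨k / (k + 1), by positivity, by rw [div_le_one hK]; linarith⟩ : unitInterval) := by
    ext l
    rw [Set.mem_ofPred_eq, lotteryBin, Nat.le_floor_iff (mul_nonneg (by positivity) l.2.1),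
      Set.mem_Ici, ← Subtype.coe_le_coe, div_le_iff₀' hK]
    push_cast
    rfl
  have hsub : 1 - (k : ℝ) / (k + 1) = ((k : ℝ) + 1)⁻¹ := by field_simp; ring
  rw [h, measureReal_def, unitInterval.volume_Ici]
  simp only [hsub]
  exact ENNReal.toReal_ofReal (by positivity)

theorem integral_ite_lotteryBin (K : ℕ) (c : ℝ) (p : ℕ → Prop) [DecidablePred p] :
    ∫ l, (if p (lotteryBin K l) then c else 0) = volume.real {l | p (lotteryBin K l)} * c := by
  have h := integral_indicator_const (μ := (volume : Measure unitInterval)) c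
    (s := {l | p (lotteryBin K l)}) (measurable_lotteryBin K
      (MeasurableSet.of_discrete (s := {n | p n})))
  rw [smul_eq_mul] at h
  simpa only [Set.indicator_apply, Set.mem_ofPred_eq] using h

theorem integrable_comp_lotteryBin (K : ℕ) {f : ℕ → ℝ} {C : ℝ} (hf : ∀ n, |f n| ≤ C) :
    Integrable fun l => f (lotteryBin K l) :=
  Integrable.of_bound (measurable_from_nat.comp (measurable_lotteryBin K)).aestronglyMeasurable C
    (Filter.Eventually.of_forall fun _ => hf _)

variable {T : Type*} [DecidableEq T]

theorem abs_binContrast_le {t t' : T} {p p' : ℝ} (hp : 0 < p) (hp' : 0 < p') (i : ℕ) (τ : T)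
    (n : ℕ) : |binContrast t t' p p' i τ n| ≤ p⁻¹ + p'⁻¹ := by
  have h1 : 0 < p⁻¹ := by positivity
  have h2 : 0 < p'⁻¹ := by positivity
  rw [binContrast, abs_le]
  constructor <;> split_ifs <;> linarith

theorem abs_topWeight_le {t' : T} {p' : ℝ} (hp' : 0 < p') (k : ℕ) (τ : T) (n : ℕ) :
    |topWeight t' p' k τ n| ≤ p'⁻¹ := by
  have h2 : 0 < p'⁻¹ := by positivity
  rw [topWeight, abs_le]
  constructor <;> split_ifs <;> linarith

theorem sum_topWeight_nonneg (t' : T) {p' : ℝ} (hp' : 0 < p') (k : ℕ) {N : ℕ}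
    (v : Fin N → T) (b : Fin N → ℕ) : 0 ≤ ∑ j, topWeight t' p' k (v j) (b j) :=
  Finset.sum_nonneg fun j _ => by rw [topWeight]; split_ifs <;> positivity

theorem measurable_binContrast (t t' : T) (p p' : ℝ) (i K : ℕ) (τ : T) :
    Measurable fun l => binContrast t t' p p' i τ (lotteryBin K l) :=
  (measurable_from_nat (f := binContrast t t' p p' i τ)).comp (measurable_lotteryBin K)

theorem measurable_topWeight (t' : T) (p' : ℝ) (k K : ℕ) (τ : T) :
    Measurable fun l => topWeight t' p' k τ (lotteryBin K l) :=
  (measurable_from_nat (f := topWeight t' p' k τ)).comp (measurable_lotteryBin K)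

/-- Bins have equal length and the weights are inverse probabilities, so both matched cells have the
same expected weight. -/
theorem sum_mul_integral_binContrast [Fintype T] {m : T → ℝ} (hm : ∀ τ, 0 < m τ) (t t' : T)
    {k i : ℕ} (hi : i < k) :
    ∑ τ, m τ * ∫ l, binContrast t t' (m t) (m t') i τ (lotteryBin (k + 1) l) = 0 := by
  have hite (σ τ : T) (n : ℕ) (hn : n < k + 1) :
      ∫ l, (if τ = σ ∧ lotteryBin (k + 1) l = n then (m σ)⁻¹ else 0) =
        if τ = σ then ((k + 1 : ℕ) : ℝ)⁻¹ * (m σ)⁻¹ else 0 := by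
    by_cases h : τ = σ
    · simp only [h, true_and, if_true]
      rw [integral_ite_lotteryBin (k + 1) _ (· = n), volume_lotteryBin_eq hn]
    · simp [h]
  have hint (σ τ : T) (n : ℕ) :
      Integrable fun l => if τ = σ ∧ lotteryBin (k + 1) l = n then (m σ)⁻¹ else 0 :=
    integrable_comp_lotteryBin (k + 1) (f := fun b => if τ = σ ∧ b = n then (m σ)⁻¹ else 0)
      (C := (m σ)⁻¹) fun b => by
        have := inv_pos.2 (hm σ)
        rw [abs_le]
        constructor <;> split_ifs <;> linarith
  have h (τ : T) : ∫ l, binContrast t t' (m t) (m t') i τ (lotteryBin (k + 1) l) =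
      (if τ = t then ((k + 1 : ℕ) : ℝ)⁻¹ * (m t)⁻¹ else 0) -
        if τ = t' then ((k + 1 : ℕ) : ℝ)⁻¹ * (m t')⁻¹ else 0 := by
    simp only [binContrast]
    rw [integral_sub (hint t τ (i + 1)) (hint t' τ i), hite t τ _ (by omega),
      hite t' τ _ (by omega)]
  have ht := (hm t).ne'
  have ht' := (hm t').ne'
  simp only [h, mul_sub, Finset.sum_sub_distrib, mul_ite, mul_zero, Finset.sum_ite_eq',
    Finset.mem_univ, if_true]
  field_simp
  ring

theorem sum_mul_integral_topWeight [Fintype T] {m : T → ℝ} (hm : ∀ τ, 0 < m τ) (t' : T) (k : ℕ) :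
    ∑ τ, m τ * ∫ l, topWeight t' (m t') k τ (lotteryBin (k + 1) l) = ((k : ℝ) + 1)⁻¹ := by
  have h (τ : T) : ∫ l, topWeight t' (m t') k τ (lotteryBin (k + 1) l) =
      if τ = t' then ((k : ℝ) + 1)⁻¹ * (m t')⁻¹ else 0 := by
    simp only [topWeight]
    by_cases h : τ = t'
    · simp only [h, true_and, if_true]
      rw [integral_ite_lotteryBin (k + 1) _ (k ≤ ·), volume_le_lotteryBin]
    · simp [h]
  have ht' := (hm t').ne'
  simp only [h, mul_ite, mul_zero, Finset.sum_ite_eq', Finset.mem_univ, if_true]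
  field_simp

/-! ### The mean of the deviation bound and its limit -/

variable {N : ℕ}

/-- A bound for the envy of students of type `t` towards students of type `t'`, in terms of the
deviations of the numbers of students from their means. -/
noncomputable def deviationBound (m : T → ℝ) (t t' : T) (k : ℕ) (v : Fin N → T)
    (ℓ : Fin N → unitInterval) : ℝ :=
  2 / (N * m t) *
    (∑ i ∈ Finset.range k,
        |∑ j, binContrast t t' (m t) (m t') i (v j) (lotteryBin (k + 1) (ℓ j))| +
      ∑ j, topWeight t' (m t') k (v j) (lotteryBin (k + 1) (ℓ j))) +
    4 / (N ^ 2 * m t ^ 2 * m t') * (∑ j, ((if v j = t then 1 else 0) - m t)) ^ 2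

theorem deviationBound_nonneg {m : T → ℝ} (hm : ∀ τ, 0 < m τ) (t t' : T) (k : ℕ)
    (v : Fin N → T) (ℓ : Fin N → unitInterval) : 0 ≤ deviationBound m t t' k v ℓ := by
  have h1 := hm t
  have h2 := hm t'
  have := sum_topWeight_nonneg t' h2 k v (fun j => lotteryBin (k + 1) (ℓ j))
  rw [deviationBound]
  positivity

variable {m : T → ℝ}

theorem integrable_binContrast (hm : ∀ τ, 0 < m τ) (t t' : T) (k i : ℕ) (v : Fin N → T) :
    Integrable fun ℓ : Fin N → unitInterval =>
      |∑ j, binContrast t t' (m t) (m t') i (v j) (lotteryBin (k + 1) (ℓ j))| :=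
  (integrable_sum_reports
    (f := fun τ l => binContrast t t' (m t) (m t') i τ (lotteryBin (k + 1) l))
    (measurable_binContrast _ _ _ _ _ _)
    (fun _ _ => abs_binContrast_le (hm t) (hm t') _ _ _) v).abs

theorem integrable_topWeight (hm : ∀ τ, 0 < m τ) (t' : T) (k : ℕ) (v : Fin N → T) :
    Integrable fun ℓ : Fin N → unitInterval =>
      ∑ j, topWeight t' (m t') k (v j) (lotteryBin (k + 1) (ℓ j)) :=
  integrable_sum_reports
    (f := fun τ l => topWeight t' (m t') k τ (lotteryBin (k + 1) l))
    (measurable_topWeight _ _ _ _)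
    (fun _ _ => abs_topWeight_le (hm t') _ _ _) v

theorem integrable_deviationBound (hm : ∀ τ, 0 < m τ) (t t' : T) (k : ℕ) (v : Fin N → T) :
    Integrable fun ℓ : Fin N → unitInterval => deviationBound m t t' k v ℓ :=
  (((integrable_finsetSum _ fun i _ => integrable_binContrast hm t t' k i v).add
    (integrable_topWeight hm t' k v)).const_mul _).add (integrable_const _)

theorem reportMean_deviationBound_le [Fintype T] (hm : ∀ τ, 0 < m τ) (hm1 : ∑ τ, m τ = 1)
    (t t' : T) (k : ℕ)
    (hN : 0 < N) :
    reportMean m (deviationBound (N := N) m t t' k) ≤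
      2 / (N * m t) * (k * (√N * (((m t)⁻¹ + (m t')⁻¹) ^ 2 + 1)) + N * ((k : ℝ) + 1)⁻¹) +
        4 / (N ^ 2 * m t ^ 2 * m t') * N := by
  have h1 := hm t
  have h2 := hm t'
  have hbin (v : Fin N → T) := integrable_finsetSum (Finset.range k)
    fun i _ => integrable_binContrast hm t t' k i v
  have hmt : m t ≤ 1 := hm1 ▸ Finset.single_le_sum (fun τ _ => (hm τ).le) (Finset.mem_univ t)
  simp only [funext₂ fun v ℓ => deviationBound.eq_1 (N := N) m t t' k v ℓ]
  have hsum (v : Fin N → T) := (hbin v).add (integrable_topWeight hm t' k v)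
  simp only [Pi.add_def] at hsum
  rw [reportMean_add (fun v => (hsum v).const_mul _) (fun v => integrable_const _),
    reportMean_const_mul, reportMean_const_mul,
    reportMean_add hbin (integrable_topWeight hm t' k),
    reportMean_finset_sum m _ fun i _ => integrable_binContrast hm t t' k i,
    reportMean_sum_reports hm1 (f := fun τ l => topWeight t' (m t') k τ (lotteryBin (k + 1) l))
      (measurable_topWeight _ _ _ _)
      (fun _ _ => abs_topWeight_le (hm t') _ _ _), sum_mul_integral_topWeight hm]
  have hS : ∑ i ∈ Finset.range k, reportMean m (fun (v : Fin N → T) ℓ =>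
      |∑ j, binContrast t t' (m t) (m t') i (v j) (lotteryBin (k + 1) (ℓ j))|) ≤
        k * (√N * (((m t)⁻¹ + (m t')⁻¹) ^ 2 + 1)) := by
    refine (Finset.sum_le_sum fun i hi => reportMean_abs_sum_reports_le (fun τ => (hm τ).le) hm1
      (f := fun τ l => binContrast t t' (m t) (m t') i τ (lotteryBin (k + 1) l))
      (measurable_binContrast _ _ _ _ _ _)
      (fun _ _ => abs_binContrast_le (hm t) (hm t') _ _ _)
      (sum_mul_integral_binContrast hm t t' (Finset.mem_range.1 hi)) hN).trans_eq ?_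
    simp
  -- The centred indicator of `t` is bounded by `1`.
  have hD : reportMean m (fun (v : Fin N → T) _ =>
      (∑ j, ((if v j = t then 1 else 0) - m t)) ^ 2) ≤ N * 1 ^ 2 := by
    refine reportMean_sq_sum_reports_le (fun τ => (hm τ).le) hm1
      (f := fun τ _ => (if τ = t then 1 else 0) - m t) (fun _ => measurable_const)
      (fun τ _ => ?_) ?_
    · rw [abs_le]
      constructor <;> split_ifs <;> linarith
    · simp [mul_sub, Finset.sum_sub_distrib, ← Finset.sum_mul, hm1]
  rw [one_pow, mul_one] at hD
  gcongr

/-- The order of choice is essential: `k` first makes the top bin's share less than `ε / 2`, and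
then, with `k` fixed, the terms of order `1 / √N` and `1 / N` tend to zero. -/
theorem exists_deviation_lt {p : ℝ} (hp : 0 < p) (C : ℝ) {p' : ℝ} (hp' : 0 < p') {ε : ℝ}
    (hε : 0 < ε) :
    ∃ k N₀ : ℕ, ∀ N : ℕ, N₀ ≤ N → 2 / (N * p) * (k * (√N * C) + N * ((k : ℝ) + 1)⁻¹) +
        4 / (N ^ 2 * p ^ 2 * p') * N < ε := by
  obtain ⟨k, hk⟩ := exists_nat_gt (2 / p * (2 / ε))
  have hk1 : 2 / p * ((k : ℝ) + 1)⁻¹ < ε / 2 := by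
    rw [← div_eq_mul_inv, div_lt_iff₀ (by positivity)]
    calc 2 / p = ε / 2 * (2 / p * (2 / ε)) := by field_simp
      _ < ε / 2 * (k + 1) := by gcongr; linarith
  have hlim : Filter.Tendsto (fun N : ℕ => 2 / p * (k * C) * (√N)⁻¹ +
      4 / (p ^ 2 * p') * (N : ℝ)⁻¹) Filter.atTop (nhds 0) := by
    have h1 : Filter.Tendsto (fun N : ℕ => (√N)⁻¹) Filter.atTop (nhds 0) :=
      tendsto_inv_atTop_zero.comp (Real.tendsto_sqrt_atTop.comp tendsto_natCast_atTop_atTop)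
    have h2 : Filter.Tendsto (fun N : ℕ => (N : ℝ)⁻¹) Filter.atTop (nhds 0) :=
      tendsto_inv_atTop_zero.comp tendsto_natCast_atTop_atTop
    simpa using (h1.const_mul (2 / p * (k * C))).add (h2.const_mul (4 / (p ^ 2 * p')))
  obtain ⟨N₀, hN₀⟩ := Filter.eventually_atTop.1 (hlim.eventually_lt_const (half_pos hε))
  refine ⟨k, max N₀ 1, fun N hN => ?_⟩
  have hN1 : (0 : ℝ) < N := by exact_mod_cast (le_max_right N₀ 1).trans hN
  have hs : (0 : ℝ) < √N := Real.sqrt_pos.2 hN1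
  have h := hN₀ N ((le_max_left _ _).trans hN)
  have hNs : (N : ℝ) = √N * √N := (Real.mul_self_sqrt hN1.le).symm
  have e1 : 2 / (N * p) * (k * (√N * C)) = 2 / p * (k * C) * (√N)⁻¹ := by
    rw [hNs, Real.sqrt_mul_self hs.le]
    field_simp
  have e2 : 2 / (N * p) * (N * ((k : ℝ) + 1)⁻¹) = 2 / p * ((k : ℝ) + 1)⁻¹ := by
    field_simp
  have e3 : 4 / (N ^ 2 * p ^ 2 * p') * N = 4 / (p ^ 2 * p') * (N : ℝ)⁻¹ := by
    field_simp
  rw [mul_add, e1, e2, e3]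
  linarith

end LotteryBins

/-! ### From absence of envy to strategy-proofness in the large -/

section Main

variable {M R N : ℕ} [NeZero R] {V : Finset (StudentType M R)}

-- The combinatorial bounds hold for each lottery draw and each outcome separately; a lower bin
-- means a smaller lottery number, hence no larger budget.
open Classical in
theorem IsOutcome.neg_deviationBound_le {α β : ℝ} (hβ : 0 ≤ β) {q : Fin M → ℕ} {v : Fin N → V}
    {ℓ : Fin N → unitInterval} {a : Allocation N M}
    (ha : IsOutcome α β q (fun s => (v s).1) (fun s => 1 + (ℓ s : ℝ) * β) a)
    {t t' : V} (htt' : t.1.prio = t'.1.prio) {u : Schedule M → ℝ}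
    (hu : ∀ A, u A ∈ Set.Icc (0 : ℝ) 1) (hpref : ∀ A B, u A ≤ u B ↔ t.1.pref.le A B)
    {m : V → ℝ} (hm : ∀ τ, 0 < m τ) (k : ℕ) {s : Fin N} (hs : (v s).1.prio = t.1.prio) :
    -deviationBound m t t' k v ℓ ≤
      ((Finset.univ.filter fun j => (v j).1.prio = t.1.prio).card : ℝ)⁻¹ *
        ∑ j, u (a j) * contrast t t' (m t) (m t') (v j) := by
  have hN : (0 : ℝ) < N := by exact_mod_cast (Nat.zero_le _).trans_lt s.2
  refine neg_le_inv_mul_of_deviation ?_ hN (hm t) (hm t') ?_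
    (neg_le_sum_mul_contrast (hm t) (hm t') v _ _ (fun j => hu (a j)) (fun i j hi hj hij => ?_) k)
    (neg_card_mul_inv_le_sum_mul_contrast (hm t) (hm t') v _ (fun j => hu (a j)) _
      fun j hj => ?_) ?_
  · exact_mod_cast Finset.card_pos.2 ⟨s, by simp [hs]⟩
  · have := sum_topWeight_nonneg t' (hm t') k v (fun j => lotteryBin (k + 1) (ℓ j))
    positivity
  · refine ha.utility_le (by simpa only [hi] using hpref) (by simp only [hi, hj, htt']) ?_
    have : (ℓ j : ℝ) ≤ ℓ i := (lt_of_lotteryBin_lt hij).le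
    gcongr
  · simp [hj, htt']
  -- The centred sum plus `N * m t` counts the reports of `t`, all of which belong to the group.
  · simp only [Finset.sum_sub_distrib, Finset.sum_const, Finset.card_univ, Fintype.card_fin,
      nsmul_eq_mul, sub_add_cancel, Finset.sum_boole, Nat.cast_le]
    exact Finset.card_le_card fun j hj => by simp_all

open Classical in
theorem IsPMP.neg_integral_deviationBound_le {α β : ℝ} (hβ : 0 ≤ β) {q : Fin M → ℕ}
    {Φ : DirectMechanism V N} (hΦ : IsPMP α β q Φ) {t t' : V} (htt' : t.1.prio = t'.1.prio)
    {u : Schedule M → ℝ} (hu : ∀ A, u A ∈ Set.Icc (0 : ℝ) 1)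
    (hpref : ∀ A B, u A ≤ u B ↔ t.1.pref.le A B) {m : V → ℝ} (hm : ∀ τ, 0 < m τ) (k : ℕ)
    {v : Fin N → V} {s : Fin N} (hs : (v s).1.prio = t.1.prio) :
    -∫ ℓ, deviationBound m t t' k v ℓ ≤
      ((Finset.univ.filter fun j => (v j).1.prio = t.1.prio).card : ℝ)⁻¹ *
        ∑ j, outcomeUtility Φ u v j * contrast t t' (m t) (m t') (v j) := by
  obtain ⟨x, hx, hout, hΦx⟩ := hΦ
  set L : Allocation N M → ℝ := fun a =>
    ((Finset.univ.filter fun j => (v j).1.prio = t.1.prio).card : ℝ)⁻¹ *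
      ∑ j, u (a j) * contrast t t' (m t) (m t') (v j) with hL
  have hint (a : Allocation N M) : Integrable fun ℓ => x v ℓ a * L a :=
    (integrable_of_measurable_of_abs_le (hx v a) (C := 1) fun ℓ => by
      rw [abs_of_nonneg (stdSimplex.zero_le _ _), ← stdSimplex.sum_eq_one (x v ℓ)]
      exact Finset.single_le_sum (f := fun a => x v ℓ a) (fun a _ => stdSimplex.zero_le _ a)
        (Finset.mem_univ a)).mul_const _
  have hsum : ((Finset.univ.filter fun j => (v j).1.prio = t.1.prio).card : ℝ)⁻¹ *
      ∑ j, outcomeUtility Φ u v j * contrast t t' (m t) (m t') (v j) =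
        ∫ ℓ, ∑ a, x v ℓ a * L a := by
    rw [integral_finsetSum _ fun a _ => hint a]
    simp only [integral_mul_const, ← hΦx, hL, outcomeUtility, Finset.sum_mul]
    rw [Finset.sum_comm, Finset.mul_sum]
    refine Finset.sum_congr rfl fun a _ => ?_
    simp only [mul_assoc, ← Finset.mul_sum]
    ring
  rw [hsum, ← integral_neg]
  refine integral_mono_ae (integrable_deviationBound hm t t' k v).neg
    (integrable_finsetSum _ fun a _ => hint a) ?_
  filter_upwards [hout v] with ℓ hℓ
  calc -deviationBound m t t' k v ℓ = ∑ a, x v ℓ a * -deviationBound m t t' k v ℓ := by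
        rw [← Finset.sum_mul, stdSimplex.sum_eq_one, one_mul]
    _ ≤ ∑ a, x v ℓ a * L a := by
        refine Finset.sum_le_sum fun a _ => ?_
        -- Only allocations selected with positive probability need be outcomes; the others have
        -- weight zero.
        rcases (stdSimplex.zero_le (x v ℓ) a).eq_or_lt with h | h
        · rw [← h, zero_mul, zero_mul]
        · exact mul_le_mul_of_nonneg_left
            ((hℓ a h).neg_deviationBound_le hβ htt' hu hpref hm k hs) h.le

open Classical in
/-- The gain from reporting `t'` in place of `t` is at most the mean of the deviation bound. -/
theorem IsPMP.expectedUtility_sub_le {α β : ℝ} (hβ : 0 ≤ β) {q : Fin M → ℕ}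
    {Φ : DirectMechanism V N} (hΦ : IsPMP α β q Φ) (hanon : IsSemiAnonymous Φ)
    {t t' : V} (htt' : t.1.prio = t'.1.prio)
    {u : Schedule M → ℝ} (hu : ∀ A, u A ∈ Set.Icc (0 : ℝ) 1)
    (hpref : ∀ A B, u A ≤ u B ↔ t.1.pref.le A B) {m : stdSimplex ℝ V} (hm : ∀ τ, 0 < m τ)
    (k : ℕ) (s : Fin N) :
    expectedUtility u (interim Φ s t' m) - expectedUtility u (interim Φ s t m) ≤
      reportMean m (deviationBound (N := N) m t t' k) := by
  have hP (v : Fin N → V) : 0 ≤ ∏ j, m (v j) := Finset.prod_nonneg fun _ _ => (hm _).le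
  have hU (τ : V) : expectedUtility u (interim Φ s τ m) =
      ∑ v : Fin N → V, (∏ j, m (v j)) *
        (outcomeUtility Φ u v s * if v s = τ then (m τ)⁻¹ else 0) := by
    rw [← inv_mul_cancel_left₀ (hm τ).ne' (expectedUtility u (interim Φ s τ m)),
      mul_expectedUtility_interim, Finset.mul_sum]
    refine Finset.sum_congr rfl fun v _ => ?_
    split_ifs <;> ring
  have hdiff : expectedUtility u (interim Φ s t m) - expectedUtility u (interim Φ s t' m) =
      ∑ v : Fin N → V, (∏ j, m (v j)) *
        (outcomeUtility Φ u v s * contrast t t' (m t) (m t') (v s)) := by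
    rw [hU, hU, ← Finset.sum_sub_distrib]
    simp only [contrast, mul_sub]
  -- The contrast vanishes outside the group because `t` and `t'` share their priorities.
  rw [sum_mul_eq_sum_mul_group_average (fun τ : V => τ.1.prio) t.1.prio s
    (fun v σ => Equiv.prod_comp σ fun j => m (v j))
    (G := fun v j => outcomeUtility Φ u v j * contrast t t' (m t) (m t') (v j))
    (fun v σ hσ j => by rw [hanon.outcomeUtility_comp u v σ hσ, Function.comp_apply])
    (fun v j hj => by
      rw [contrast, if_neg (by rintro rfl; exact hj rfl),
        if_neg (by rintro rfl; exact hj htt'.symm), sub_zero, mul_zero])] at hdiff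
  rw [← neg_le_neg_iff, neg_sub, hdiff, reportMean, ← Finset.sum_neg_distrib]
  refine Finset.sum_le_sum fun v _ => ?_
  rw [← mul_neg]
  refine mul_le_mul_of_nonneg_left ?_ (hP v)
  split_ifs with hs
  · exact hΦ.neg_integral_deviationBound_le hβ htt' hu hpref hm k hs
  · exact neg_nonpos.2 (integral_nonneg fun ℓ => deviationBound_nonneg hm t t' k v ℓ)

end Main

end CourseAllocation

open CourseAllocation in
theorem theorem5 {M R : ℕ} [NeZero R] (V : Finset (StudentType M R))
    (u : V → Schedule M → ℝ) (hu : ∀ t A, u t A ∈ Set.Icc (0 : ℝ) 1)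
    (hpref : ∀ (t : V) (A B : Schedule M), u t A ≤ u t B ↔ t.1.pref.le A B)
    (α β : ℝ) (hα : 0 ≤ α) (hβ : 0 ≤ β) (q : ℕ → Fin M → ℕ)
    (Φ : ∀ N, DirectMechanism V N)
    (hpmp : ∀ N, IsPMP α β (q N) (Φ N)) (hanon : ∀ N, IsSemiAnonymous (Φ N)) :
    IsStrategyProofInTheLarge u Φ := by
  classical
  intro m hm ε hε
  have hex (t t' : V) := exists_deviation_lt (hm t) (((m t)⁻¹ + (m t')⁻¹) ^ 2 + 1) (hm t') hε
  choose k N₀ hN₀ using hex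
  -- There are finitely many pairs of types, so one threshold serves them all.
  refine ⟨Finset.univ.sup fun τ : V × V => N₀ τ.1 τ.2, fun N hN s t t' htt' => ?_⟩
  have hN' : N₀ t t' ≤ N :=
    (Finset.le_sup (f := fun τ : V × V => N₀ τ.1 τ.2) (Finset.mem_univ (t, t'))).trans hN
  have h1 := (hpmp N).expectedUtility_sub_le hβ (hanon N) htt' (hu t) (hpref t) hm (k t t') s
  have h2 := reportMean_deviationBound_le (N := N) hm (stdSimplex.sum_eq_one m) t t' (k t t')
    ((Nat.zero_le _).trans_lt s.2)
  have h3 := hN₀ t t' N hN'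
  linarith
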